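/- All graphs are finite and simple. For a family $\mathcal{H}$ of graphs, a graph is $\mathcal{H}$-free if it contains no member of $\mathcal{H}$ as a (not necessarily induced) subgraph; $\delta(G)$ denotes the minimum degree of $G$; and $G$ is homomorphic to $G'$ if there is a map $V(G)\to V(G')$ that sends edges to edges. The homomorphism threshold $\delta_{\hom}(\mathcal{H})$ is the infimum of all $d\in[0,1]$ for which there is a constant $C=C(\mathcal{H},d)$ such that every $\mathcal{H}$-free graph $G$ with $\delta(G)\ge d\,|V(G)|$ is homomorphic to an $\mathcal{H}$-free graph on at most $C$ vertices. For $k\ge 1$ let $F_k$ be the graph obtained from a cycle of length $5k-3$ (an edge, when $k=1$) by adding all chords joining vertices at distance $5j+1$ along the cycle, $0\le j\le k-1$. Theorem. The homomorphism threshold of $\{C_3,C_5\}$ is $$\delta_{\hom}(\{C_3,C_5\})=\tfrac15 .$$ More precisely: (1) For every $\varepsilon>0$ there is a constant $C=C(\varepsilon)$ such that every $\{C_3,C_5\}$-free graph $G$ on $n$ vertices with $\delta(G)\ge(\tfrac15+\varepsilon)n$ is homomorphic to a $\{C_3,C_5\}$-free graph on at most $C$ vertices. (2) For every $k\ge1$,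 the graph $F_k$ is $\{C_3,C_5\}$-free, has minimum degree at least $|V(F_k)|/5$, and is not homomorphic to any $\{C_3,C_5\}$-free graph with fewer than $|V(F_k)|$ vertices. -/

import Mathlib

open SimpleGraph

/-- A family of finite graphs, each given on a vertex set `Fin n`. -/
abbrev GraphFamily := Set (Σ n : ℕ, SimpleGraph (Fin n))

/-- `G` is `𝓗`-free: no member of `𝓗` is (isomorphic to) a subgraph of `G`,
induced or not. -/
def FamilyFree (𝓗 : GraphFamily) {V : Type*} (G : SimpleGraph V) : Prop :=
  ∀ H ∈ 𝓗, H.2.Free G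

/-- `G` is homomorphic to some `𝓗`-free graph with at most `C` vertices. -/
def HomToFreeOfOrderLE (𝓗 : GraphFamily) (C : ℕ) {V : Type*} (G : SimpleGraph V) : Prop :=
  ∃ (m : ℕ) (G' : SimpleGraph (Fin m)), m ≤ C ∧ FamilyFree 𝓗 G' ∧ Nonempty (G →g G')

open Classical in
/-- The homomorphism threshold of `𝓗`: the infimum of all `d ∈ [0, 1]` for which there is a `C`
such that every finite `𝓗`-free graph `G` of minimum degree at least `d * |V(G)|` is homomorphic
to an `𝓗`-free graph on at most `C` vertices. -/
noncomputable def homThreshold (𝓗 : GraphFamily) : ℝ :=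
  sInf {d : ℝ | d ∈ Set.Icc (0 : ℝ) 1 ∧ ∃ C : ℕ,
    ∀ (V : Type) [Fintype V] (G : SimpleGraph V), FamilyFree 𝓗 G →
      d * (Fintype.card V : ℝ) ≤ (G.minDegree : ℝ) → HomToFreeOfOrderLE 𝓗 C G}

/-- The family `{C₃, C₅}`. -/
def C3C5 : GraphFamily := {⟨3, cycleGraph 3⟩, ⟨5, cycleGraph 5⟩}

/-- The graph `F_k` (`k ≥ 1`): the vertices are the residues modulo `5 * (k - 1) + 2 = 5 * k - 3`,
and two of them are adjacent iff they differ, in one of the two directions around the cycle, by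
`5 * j + 1` for some `0 ≤ j ≤ k - 1` (the value `j = 0` gives the cycle itself). -/
def andrasfaiF (k : ℕ) : SimpleGraph (Fin (5 * (k - 1) + 2)) :=
  circulantGraph {x | ∃ j < k, x.val = 5 * j + 1}

/-! A graph is {C₃, C₅}-free exactly when it has no closed walk of length five. Along an edge of F_k
the integer label goes up by 1 mod 5 or down by 1 mod 5, so a closed five-walk would have to be
monotone, which is absurd. On the other hand any two distinct vertices are joined by a five-walk, so
a homomorphism to a {C₃, C₅}-free graph identifies no two of them.

For the upper bound, almost all vertices are split into boundedly many parts, each inside a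
neighbourhood. Vertices are coloured by their rounded degrees into the parts, and the colouring is
refined seven times by the colours seen on neighbours. A closed five-walk in the quotient lifts to a
walk of seven edges in G with 5-periodic colours (`exists_walk_of_quotient_walk`). Into each part,
its first five vertices send in total little more than the size of the part
(`sum_partDegree_le_of_periodic`), so their degrees sum to little more than n, against the required
(1 + 5ε)n. -/

/-! ### Closed walks of length five -/

/-- If two vertices at distance two along the walk coincide, the other three edges form a triangle;
otherwise the walk is a C₅. -/
theorem closed_five_walk_false {V : Type*} {G : SimpleGraph V} (hG : FamilyFree C3C5 G)
    {a b c d e : V} (hab : G.Adj a b) (hbc : G.Adj b c) (hcd : G.Adj c d) (hde : G.Adj d e)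
    (hea : G.Adj e a) : False := by
  have h3 : ∀ x y z : V, G.Adj x y → G.Adj y z → G.Adj z x → False := by
    intro x y z hxy hyz hzx
    refine hG ⟨3, cycleGraph 3⟩ (by simp [C3C5]) ⟨⟨⟨![x, y, z], ?_⟩, ?_⟩⟩
    · intro i j hij
      have := hxy.symm; have := hyz.symm; have := hzx.symm
      fin_cases i <;> fin_cases j <;> simp_all [cycleGraph_adj]
    · have := hxy.ne; have := hyz.ne; have := hzx.ne
      intro i j hij
      fin_cases i <;> fin_cases j <;> simp_all
  have hac : a ≠ c := by rintro rfl; exact h3 _ _ _ hcd hde hea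
  have hbd : b ≠ d := by rintro rfl; exact h3 _ _ _ hde hea hab
  have hce : c ≠ e := by rintro rfl; exact h3 _ _ _ hea hab hbc
  have hda : d ≠ a := by rintro rfl; exact h3 _ _ _ hab hbc hcd
  have heb : e ≠ b := by rintro rfl; exact h3 _ _ _ hbc hcd hde
  refine hG ⟨5, cycleGraph 5⟩ (by simp [C3C5]) ⟨⟨⟨![a, b, c, d, e], ?_⟩, ?_⟩⟩
  · intro i j hij
    have := hab.symm; have := hbc.symm; have := hcd.symm; have := hde.symm; have := hea.symm
    change (cycleGraph 5).Adj i j at hij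
    rw [cycleGraph_adj] at hij
    fin_cases i <;> fin_cases j <;> first | assumption | (exact absurd hij (by decide))
  · have := hab.ne; have := hbc.ne; have := hcd.ne; have := hde.ne; have := hea.ne
    intro i j hij
    fin_cases i <;> fin_cases j <;> first | rfl | (simp at hij; simp_all)

theorem familyFree_of_no_closed_five_walk {V : Type*} {G : SimpleGraph V}
    (h : ∀ a b c d e : V, G.Adj a b → G.Adj b c → G.Adj c d → G.Adj d e → G.Adj e a → False) :
    FamilyFree C3C5 G := by
  rintro H (rfl | rfl) ⟨f⟩
  · have key : ∀ i j : Fin 3, (cycleGraph 3).Adj i j → G.Adj (f i) (f j) :=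
      fun i j hij => f.toHom.map_adj hij
    have h01 := key 0 1 (by rw [cycleGraph_adj]; decide)
    exact h _ _ _ _ _ h01 h01.symm h01 (key 1 2 (by rw [cycleGraph_adj]; decide))
      (key 2 0 (by rw [cycleGraph_adj]; decide))
  · have key : ∀ i j : Fin 5, (cycleGraph 5).Adj i j → G.Adj (f i) (f j) :=
      fun i j hij => f.toHom.map_adj hij
    exact h _ _ _ _ _ (key 0 1 (by rw [cycleGraph_adj]; decide))
      (key 1 2 (by rw [cycleGraph_adj]; decide)) (key 2 3 (by rw [cycleGraph_adj]; decide))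
      (key 3 4 (by rw [cycleGraph_adj]; decide)) (key 4 0 (by rw [cycleGraph_adj]; decide))

/-! ### The graphs F_k -/

/-- Since 5k - 3 ≡ 2 mod 5, the differences x and 5k - 3 - x are 1 mod 5 together, so wrapping
around the cycle can be ignored. -/
theorem andrasfaiF_adj_iff {k : ℕ} (hk : 1 ≤ k) (u v : Fin (5 * (k - 1) + 2)) :
    (andrasfaiF k).Adj u v ↔
      (u.val < v.val ∧ (v.val - u.val) % 5 = 1) ∨ (v.val < u.val ∧ (u.val - v.val) % 5 = 1) := by
  obtain ⟨K, rfl⟩ : ∃ K, k = K + 1 := ⟨k - 1, by omega⟩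
  have hu : u.val < 5 * K + 2 := u.2
  have hv : v.val < 5 * K + 2 := v.2
  have hsub : ∀ a b : Fin (5 * (K + 1 - 1) + 2), (a - b).val =
      if b.val ≤ a.val then a.val - b.val else 5 * K + 2 + a.val - b.val := by
    intro a b
    have ha : a.val < 5 * K + 2 := a.2
    have hb : b.val < 5 * K + 2 := b.2
    rw [Fin.sub_def]
    show (5 * K + 2 - b.val + a.val) % (5 * K + 2) = _
    split_ifs with h
    · rw [show 5 * K + 2 - b.val + a.val = (a.val - b.val) + (5 * K + 2) by omega,
        Nat.add_mod_right, Nat.mod_eq_of_lt (by omega)]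
    · rw [Nat.mod_eq_of_lt (by omega)]; omega
  have hex : ∀ x : ℕ, x < 5 * K + 2 → ((∃ j < K + 1, x = 5 * j + 1) ↔ x % 5 = 1) := by
    intro x hx
    constructor
    · rintro ⟨j, -, rfl⟩; omega
    · intro h; exact ⟨x / 5, by omega, by omega⟩
  simp only [andrasfaiF, circulantGraph, fromRel_adj, Set.mem_ofPred_eq]
  rw [hex _ (u - v).2, hex _ (v - u).2, hsub, hsub, ne_eq, Fin.ext_iff]
  split_ifs <;> omega

theorem andrasfaiF_free {k : ℕ} (hk : 1 ≤ k) : FamilyFree C3C5 (andrasfaiF k) := by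
  apply familyFree_of_no_closed_five_walk
  intro a b c d e hab hbc hcd hde hea
  rw [andrasfaiF_adj_iff hk] at hab hbc hcd hde hea
  -- A sum of five signs is divisible by 5 only if all of them agree.
  omega

open Classical in
theorem le_minDegree_andrasfaiF {k : ℕ} (hk : 1 ≤ k) : k ≤ (andrasfaiF k).minDegree := by
  apply le_minDegree_of_forall_le_degree
  intro v
  let s : ℕ → Fin (5 * (k - 1) + 2) := fun j => Fin.ofNat _ (5 * j + 1)
  have hs : ∀ j < k, (s j).val = 5 * j + 1 := fun j hj => Nat.mod_eq_of_lt (by omega)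
  have hinj : Set.InjOn (fun j => v + s j) (Finset.range k : Set ℕ) := by
    intro i hi j hj hij
    have h := congrArg Fin.val (add_left_cancel hij)
    rw [hs i (by simpa using hi), hs j (by simpa using hj)] at h
    omega
  calc k = ((Finset.range k).image fun j => v + s j).card := by
        rw [Finset.card_image_of_injOn hinj, Finset.card_range]
    _ ≤ (andrasfaiF k).degree v := by
        apply Finset.card_le_card
        intro u hu
        obtain ⟨j, hj, rfl⟩ := Finset.mem_image.1 hu
        have hj' : j < k := by simpa using hj
        rw [mem_neighborFinset]
        simp only [andrasfaiF, circulantGraph, fromRel_adj, Set.mem_ofPred_eq]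
        refine ⟨fun h => ?_, Or.inr ⟨j, hj', by rw [add_sub_cancel_left, hs j hj']⟩⟩
        have h0 : s j = 0 := by simpa using h.symm
        have := hs j hj'
        rw [h0] at this
        simp at this

/-- The residue of `v - u` mod 5 dictates the numbers of up and down steps. Where down steps lack
room below `u`, they are made above `v`, and `N % 5 = 2` guarantees the room there. -/
theorem exists_five_walk_nat {N u v : ℕ} (hN : N % 5 = 2) (huv : u < v) (hv : v < N) :
    ∃ x : Fin 6 → ℕ, x 0 = u ∧ x 5 = v ∧ (∀ i, x i < N) ∧ ∀ i : Fin 5,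
      (x i.castSucc < x i.succ ∧ (x i.succ - x i.castSucc) % 5 = 1) ∨
      (x i.succ < x i.castSucc ∧ (x i.castSucc - x i.succ) % 5 = 1) := by
  have key : ∀ a b c d : ℕ, a < N → b < N → c < N → d < N →
      ((u < a ∧ (a - u) % 5 = 1) ∨ (a < u ∧ (u - a) % 5 = 1)) →
      ((a < b ∧ (b - a) % 5 = 1) ∨ (b < a ∧ (a - b) % 5 = 1)) →
      ((b < c ∧ (c - b) % 5 = 1) ∨ (c < b ∧ (b - c) % 5 = 1)) →
      ((c < d ∧ (d - c) % 5 = 1) ∨ (d < c ∧ (c - d) % 5 = 1)) →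
      ((d < v ∧ (v - d) % 5 = 1) ∨ (v < d ∧ (d - v) % 5 = 1)) →
      ∃ x : Fin 6 → ℕ, x 0 = u ∧ x 5 = v ∧ (∀ i, x i < N) ∧ ∀ i : Fin 5,
        (x i.castSucc < x i.succ ∧ (x i.succ - x i.castSucc) % 5 = 1) ∨
        (x i.succ < x i.castSucc ∧ (x i.castSucc - x i.succ) % 5 = 1) := by
    intro a b c d ha hb hc hd h0 h1 h2 h3 h4
    refine ⟨![u, a, b, c, d, v], rfl, rfl, ?_, ?_⟩
    · intro i
      fin_cases i
      exacts [huv.trans hv, ha, hb, hc, hd, hv]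
    · intro i
      fin_cases i
      exacts [h0, h1, h2, h3, h4]
  obtain h | h | h | h | h : (v - u) % 5 = 0 ∨ (v - u) % 5 = 1 ∨ (v - u) % 5 = 2 ∨
      (v - u) % 5 = 3 ∨ (v - u) % 5 = 4 := by omega
  · apply key (u + 1) (u + 2) (u + 3) (u + 4) <;> omega
  · apply key v u v u <;> omega
  · obtain h' | h' | h' | h' | h' : u = 0 ∨ u = 1 ∨ u = 2 ∨ u = 3 ∨ 4 ≤ u := by omega
    · apply key (v + 4) (v + 3) (v + 2) (v + 1) <;> omega
    · apply key (u - 1) (v + 3) (v + 2) (v + 1) <;> omega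
    · apply key (u - 1) (u - 2) (v + 2) (v + 1) <;> omega
    · apply key (u - 1) (u - 2) (u - 3) (v + 1) <;> omega
    · apply key (u - 1) (u - 2) (u - 3) (u - 4) <;> omega
  · apply key (u + 1) (u + 2) (u + 1) (u + 2) <;> omega
  · obtain h' | h' | h' : u = 0 ∨ u = 1 ∨ 2 ≤ u := by omega
    · apply key (v + 2) (v + 1) v (v + 1) <;> omega
    · apply key (u - 1) (v + 1) v (v + 1) <;> omega
    · apply key (u - 1) (u - 2) (u - 1) (u - 2) <;> omega

theorem andrasfaiF_hom_injective {k : ℕ} (hk : 1 ≤ k) {W : Type*} {H : SimpleGraph W}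
    (hH : FamilyFree C3C5 H) (f : andrasfaiF k →g H) : Function.Injective f := by
  have key : ∀ u v : Fin (5 * (k - 1) + 2), u.val < v.val → f u ≠ f v := by
    intro u v huv hf
    obtain ⟨x, h0, h5, hx, hadj⟩ := exists_five_walk_nat (by omega) huv v.2
    have hA : ∀ i : Fin 5, H.Adj (f ⟨x i.castSucc, hx _⟩) (f ⟨x i.succ, hx _⟩) :=
      fun i => f.map_adj ((andrasfaiF_adj_iff hk _ _).2 (hadj i))
    have e0 : (⟨x 0, hx 0⟩ : Fin (5 * (k - 1) + 2)) = u := Fin.ext h0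
    have e5 : (⟨x 5, hx 5⟩ : Fin (5 * (k - 1) + 2)) = v := Fin.ext h5
    have hlast : H.Adj (f ⟨x 4, hx 4⟩) (f ⟨x 0, hx 0⟩) := by
      rw [e0, hf, ← e5]; exact hA 4
    exact closed_five_walk_false hH (hA 0) (hA 1) (hA 2) (hA 3) hlast
  intro u v huv
  rcases lt_trichotomy u.val v.val with h | h | h
  · exact absurd huv (key u v h)
  · exact Fin.ext h
  · exact absurd huv.symm (key v u h)

/-! ### Degrees into the parts of a partition -/

open Classical in
/-- The number of neighbours of `v` in the part of the partition `p` labelled `o`. -/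
noncomputable def partDegree {V ι : Type*} [Fintype V] (G : SimpleGraph V) (p : V → ι) (v : V)
    (o : ι) : ℕ :=
  (Finset.univ.filter fun x => G.Adj v x ∧ p x = o).card

open Classical in
/-- The size of the part of the partition `p` labelled `o`. -/
noncomputable def partSize {V ι : Type*} [Fintype V] (p : V → ι) (o : ι) : ℕ :=
  (Finset.univ.filter fun x => p x = o).card

section

variable {V : Type*} [Fintype V] {G : SimpleGraph V} {ι : Type*}

open Classical in
theorem sum_partDegree [Fintype ι] (p : V → ι) (v : V) :
    ∑ o, partDegree G p v o = G.degree v := by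
  rw [← card_neighborFinset_eq_degree,
    Finset.card_eq_sum_card_fiberwise (f := p) (t := Finset.univ) (fun _ _ => by simp)]
  refine Finset.sum_congr rfl fun o _ => ?_
  unfold partDegree
  congr 1
  ext x
  simp

open Classical in
theorem sum_partSize [Fintype ι] (p : V → ι) : ∑ o, partSize p o = Fintype.card V := by
  rw [← Finset.card_univ,
    Finset.card_eq_sum_card_fiberwise (f := p) (t := Finset.univ) (fun _ _ => by simp)]
  rfl

theorem partDegree_le_partSize (p : V → ι) (v : V) (o : ι) :
    partDegree G p v o ≤ partSize p o :=
  Finset.card_le_card fun x hx => by simp at hx ⊢; exact hx.2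

theorem partDegree_add_le {p : V → ι} {u v : V} (huv : ∀ x, G.Adj u x → ¬ G.Adj v x) (o : ι) :
    partDegree G p u o + partDegree G p v o ≤ partSize p o := by
  classical
  unfold partDegree partSize
  rw [← Finset.card_union_of_disjoint]
  · apply Finset.card_le_card
    intro x hx
    simp at hx ⊢
    tauto
  · rw [Finset.disjoint_left]
    intro x hx hx'
    simp at hx hx'
    exact huv x hx.1 hx'.1

/-- Otherwise `u`, `v`, a neighbour of each in the part, and `w` form a closed five-walk. -/
theorem partDegree_eq_zero_or (hG : FamilyFree C3C5 G) {p : V → ι} {u v : V} (huv : G.Adj u v)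
    {o : ι} {w : V} (hw : ∀ x, p x = o → G.Adj w x) :
    partDegree G p u o = 0 ∨ partDegree G p v o = 0 := by
  classical
  by_contra! h
  obtain ⟨x, hx⟩ := Finset.card_ne_zero.1 h.1
  obtain ⟨y, hy⟩ := Finset.card_ne_zero.1 h.2
  simp at hx hy
  exact closed_five_walk_false hG huv hy.1 (hw y hy.2).symm (hw x hx.2) hx.1.symm

/-- Cyclically, no two consecutive vertices both reach the part, so at most two of the five do.
Those two are three steps apart in one direction, hence have disjoint neighbourhoods. Pairs that
wrap around use `v 5`, `v 6`, `v 7`, at the cost of `t`. -/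
theorem sum_partDegree_le_of_periodic (hG : FamilyFree C3C5 G) {p : V → ι} {o : ι} {w : V}
    (hw : ∀ x, p x = o → G.Adj w x) {v : ℕ → V} (hv : ∀ i < 7, G.Adj (v i) (v (i + 1))) {t : ℝ}
    (hnt : 0 ≤ t) (h0 : partDegree G p (v 5) o = 0 → partDegree G p (v 0) o = 0)
    (ht : ∀ i < 3, (partDegree G p (v i) o : ℝ) ≤ partDegree G p (v (i + 5)) o + t) :
    ∑ i ∈ Finset.range 5, (partDegree G p (v i) o : ℝ) ≤ partSize p o + t := by
  have hadj : ∀ i < 7, (partDegree G p (v i) o : ℝ) = 0 ∨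
      (partDegree G p (v (i + 1)) o : ℝ) = 0 := fun i hi => by
    exact_mod_cast partDegree_eq_zero_or hG (hv i hi) hw
  have hdist : ∀ i < 5, (partDegree G p (v i) o : ℝ) + partDegree G p (v (i + 3)) o ≤
      partSize p o := fun i hi => by
    refine mod_cast partDegree_add_le (fun x hx hx' => ?_) o
    exact closed_five_walk_false hG (hv i (by omega)) (hv (i + 1) (by omega))
      (hv (i + 2) (by omega)) hx' hx.symm
  have h0' : (partDegree G p (v 5) o : ℝ) = 0 → (partDegree G p (v 0) o : ℝ) = 0 := by
    exact_mod_cast h0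
  have hnn : ∀ i, (0 : ℝ) ≤ partDegree G p (v i) o := fun i => Nat.cast_nonneg _
  have a0 := hadj 0 (by norm_num)
  have a1 := hadj 1 (by norm_num)
  have a2 := hadj 2 (by norm_num)
  have a3 := hadj 3 (by norm_num)
  have a4 := hadj 4 (by norm_num)
  have d0 := hdist 0 (by norm_num)
  have d1 := hdist 1 (by norm_num)
  have d2 := hdist 2 (by norm_num)
  have d3 := hdist 3 (by norm_num)
  have d4 := hdist 4 (by norm_num)
  have t0 := ht 0 (by norm_num)
  have t1 := ht 1 (by norm_num)
  have t2 := ht 2 (by norm_num)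
  have n0 := hnn 0
  have n1 := hnn 1
  have n2 := hnn 2
  have n3 := hnn 3
  have n4 := hnn 4
  have n5 := hnn 5
  have n6 := hnn 6
  have n7 := hnn 7
  simp only [Finset.sum_range_succ, Finset.sum_range_zero, zero_add, Nat.reduceAdd] at *
  generalize (partDegree G p (v 0) o : ℝ) = c0 at *
  generalize (partDegree G p (v 1) o : ℝ) = c1 at *
  generalize (partDegree G p (v 2) o : ℝ) = c2 at *
  generalize (partDegree G p (v 3) o : ℝ) = c3 at *
  generalize (partDegree G p (v 4) o : ℝ) = c4 at *
  generalize (partDegree G p (v 5) o : ℝ) = c5 at *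
  -- Closing the cycle needs zeros to transfer exactly, not just up to `t`.
  have b0 : c4 = 0 ∨ c0 = 0 := a4.imp_right h0'
  rcases a0 with h | h <;> rcases a1 with h' | h' <;> rcases a2 with h'' | h'' <;>
    rcases a3 with h3 | h3 <;> rcases b0 with h4 | h4 <;> linarith

end

/-! ### Colour refinement and quotients -/

section

variable {V : Type*} (G : SimpleGraph V)

/-- The types of depth `i` over the colours `α`: a type of depth `i + 1` is a type of depth `i`
together with a set of types of depth `i`. -/
def DepthType (α : Type) : ℕ → Type
  | 0 => α
  | i + 1 => DepthType α i × Set (DepthType α i)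

instance DepthType.finite (α : Type) [Finite α] : ∀ i, Finite (DepthType α i)
  | 0 => inferInstanceAs (Finite α)
  | i + 1 => by
    have := DepthType.finite α i
    exact inferInstanceAs (Finite (DepthType α i × Set (DepthType α i)))

/-- Iterated colour refinement: the type of depth `i + 1` of a vertex records its type of depth `i`
and the set of types of depth `i` of its neighbours. -/
def refineColoring {α : Type} (c : V → α) : (i : ℕ) → V → DepthType α i
  | 0 => c
  | i + 1 => fun v => (refineColoring c i v, refineColoring c i '' G.neighborSet v)

variable {G}

theorem refineColoring_eq_of_le {α : Type} {c : V → α} {i j : ℕ} (hij : i ≤ j) {u v : V}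
    (h : refineColoring G c j u = refineColoring G c j v) :
    refineColoring G c i u = refineColoring G c i v := by
  induction j, hij using Nat.le_induction with
  | base => exact h
  | succ j _ ih => exact ih (congrArg Prod.fst h)

theorem exists_adj_refineColoring_eq {α : Type} {c : V → α} {i : ℕ} {u v w : V}
    (h : refineColoring G c (i + 1) u = refineColoring G c (i + 1) v) (huw : G.Adj u w) :
    ∃ x, G.Adj v x ∧ refineColoring G c i x = refineColoring G c i w := by
  have h2 : refineColoring G c i '' G.neighborSet u = refineColoring G c i '' G.neighborSet v :=
    congrArg Prod.snd h
  obtain ⟨x, hx, hxw⟩ : refineColoring G c i w ∈ refineColoring G c i '' G.neighborSet v :=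
    h2 ▸ ⟨w, huw, rfl⟩
  exact ⟨x, hx, hxw⟩

/-- A closed walk in the quotient by types lifts to a walk which is periodic in its colours. -/
theorem exists_walk_of_quotient_walk {α : Type} {c : V → α} {L : ℕ} {a b : ℕ → V}
    (hab : ∀ i, G.Adj (a i) (b (i + 1)))
    (hba : ∀ i, refineColoring G c L (b i) = refineColoring G c L (a i)) :
    ∃ v : ℕ → V, (∀ i < L, G.Adj (v i) (v (i + 1))) ∧ ∀ i ≤ L, c (v i) = c (a i) := by
  -- Each step of the lifted walk spends one level of refinement: the `i`-th vertex agrees with `a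
  -- i` at depth `L - i`.
  have step : ∀ i x, ∃ y, i < L →
      refineColoring G c (L - i) x = refineColoring G c (L - i) (a i) →
      G.Adj x y ∧
        refineColoring G c (L - (i + 1)) y = refineColoring G c (L - (i + 1)) (a (i + 1)) := by
    intro i x
    by_cases h : i < L ∧ refineColoring G c (L - i) x = refineColoring G c (L - i) (a i)
    · obtain ⟨hi, hx⟩ := h
      rw [show L - i = L - (i + 1) + 1 by omega] at hx
      obtain ⟨y, hy, hyb⟩ := exists_adj_refineColoring_eq hx.symm (hab i)
      exact ⟨y, fun _ _ => ⟨hy, hyb.trans (refineColoring_eq_of_le (Nat.sub_le _ _) (hba _))⟩⟩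
    · exact ⟨x, fun hi hx => absurd ⟨hi, hx⟩ h⟩
  choose f hf using step
  let v : ℕ → V := fun i => Nat.rec (a 0) f i
  have hv : ∀ i ≤ L, refineColoring G c (L - i) (v i) = refineColoring G c (L - i) (a i) := by
    intro i
    induction i with
    | zero => exact fun _ => rfl
    | succ i ih => exact fun hi => (hf i (v i) hi (ih (by omega))).2
  exact ⟨v, fun i hi => (hf i (v i) hi (hv i hi.le)).1,
    fun i hi => refineColoring_eq_of_le (Nat.zero_le _) (hv i hi)⟩

/-- If the quotient by the colour classes has no closed walk of length five, then it is
`{C₃, C₅}`-free and receives a homomorphism from the graph. -/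
theorem homToFree_of_coloring {α : Type} [Finite α] (c : V → α)
    (h : ∀ a b : ℕ → V, (∀ i, G.Adj (a i) (b (i + 1))) → (∀ i, c (b i) = c (a i)) →
      (∀ i, a (i + 5) = a i) → False) :
    HomToFreeOfOrderLE C3C5 (Nat.card α) G := by
  obtain ⟨e⟩ : Nonempty (α ≃ Fin (Nat.card α)) := ⟨Finite.equivFin α⟩
  have hcyc : ∀ a b : Fin 5 → V, (∀ i, G.Adj (a i) (b (i + 1))) → (∀ i, c (b i) = c (a i)) →
      False := by
    intro a b hab hba
    refine h (fun i => a (Fin.ofNat 5 i)) (fun i => b (Fin.ofNat 5 i)) (fun i => ?_)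
      (fun i => hba _) (fun i => ?_)
    · convert hab (Fin.ofNat 5 i) using 2
      ext
      simp [Fin.val_add]
    · congr 1
      ext
      simp
  -- An edge inside a class is a loop of the quotient, which can be traversed five times.
  have hproper : ∀ u v, G.Adj u v → c u ≠ c v := by
    intro u v huv hc
    exact hcyc (fun _ => u) (fun _ => v) (fun _ => huv) (fun _ => hc.symm)
  let G' : SimpleGraph (Fin (Nat.card α)) :=
    { Adj := fun x y => ∃ u v, G.Adj u v ∧ e (c u) = x ∧ e (c v) = y
      symm := ⟨fun x y ⟨u, v, huv, hx, hy⟩ => ⟨v, u, huv.symm, hy, hx⟩⟩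
      loopless := ⟨fun x ⟨u, v, huv, hx, hy⟩ => hproper u v huv (e.injective (hx.trans hy.symm))⟩ }
  refine ⟨_, G', le_rfl, ?_, ⟨⟨fun v => e (c v), fun {u v} huv => ⟨u, v, huv, rfl, rfl⟩⟩⟩⟩
  apply familyFree_of_no_closed_five_walk
  rintro _ _ _ _ _ ⟨u0, v1, h0, rfl, rfl⟩ ⟨u1, v2, h1, e1, rfl⟩ ⟨u2, v3, h2, e2, rfl⟩
    ⟨u3, v4, h3, e3, rfl⟩ ⟨u4, v0, h4, e4, e0⟩
  refine hcyc ![u0, u1, u2, u3, u4] ![v0, v1, v2, v3, v4] ?_ ?_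
  · intro i
    fin_cases i
    exacts [h0, h1, h2, h3, h4]
  · intro i
    fin_cases i
    exacts [e.injective e0, (e.injective e1).symm, (e.injective e2).symm, (e.injective e3).symm,
      (e.injective e4).symm]

end

/-! ### Covering by neighbourhoods and density colours -/

open Classical in
/-- Greedy covering by neighbourhoods. -/
theorem exists_cover_by_neighborSets {V : Type*} [Fintype V] [Nonempty V] {G : SimpleGraph V}
    (hdeg : ∀ v, Fintype.card V ≤ 5 * G.degree v) (m : ℕ) :
    ∃ w : Fin m → V, ((Finset.univ.filter fun x => ∀ j, ¬ G.Adj (w j) x).card : ℝ) ≤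
      (4 / 5 : ℝ) ^ m * Fintype.card V := by
  induction m with
  | zero => exact ⟨Fin.elim0, by simp⟩
  | succ m ih =>
    obtain ⟨w, hw⟩ := ih
    set U := Finset.univ.filter fun x => ∀ j, ¬ G.Adj (w j) x with hU
    have hcount : ∑ y : V, (U.filter (G.Adj y)).card = ∑ x ∈ U, G.degree x := by
      have := Finset.sum_card_bipartiteAbove_eq_sum_card_bipartiteBelow
        (s := Finset.univ) (t := U) G.Adj
      refine this.trans (Finset.sum_congr rfl fun x _ => ?_)
      rw [← card_neighborFinset_eq_degree]
      congr 1
      ext y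
      simp [Finset.bipartiteBelow, G.adj_comm]
    -- By averaging, some `y` is adjacent to at least a fifth of the uncovered set.
    obtain ⟨y, -, hy⟩ : ∃ y ∈ (Finset.univ : Finset V), U.card ≤ 5 * (U.filter (G.Adj y)).card := by
      apply Finset.exists_le_of_sum_le Finset.univ_nonempty
      rw [← Finset.mul_sum, hcount, Finset.mul_sum, Finset.sum_const, Finset.card_univ, smul_eq_mul,
        mul_comm, ← smul_eq_mul, ← Finset.sum_const]
      exact Finset.sum_le_sum fun x _ => hdeg x
    refine ⟨Fin.cons y w, ?_⟩
    have hsplit := Finset.card_filter_add_card_filter_not (s := U) (G.Adj y)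
    have hnew : (Finset.univ.filter fun x => ∀ j, ¬ G.Adj ((Fin.cons y w : Fin (m + 1) → V) j) x) =
        U.filter fun x => ¬ G.Adj y x := by
      ext x
      simp [hU, Fin.forall_fin_succ, and_comm]
    rw [hnew]
    have h1 : (U.card : ℝ) ≤ 5 * (U.filter (G.Adj y)).card := by exact_mod_cast hy
    have h2 : ((U.filter (G.Adj y)).card : ℝ) + (U.filter fun x => ¬ G.Adj y x).card = U.card := by
      exact_mod_cast hsplit
    rw [pow_succ]
    linarith

open Classical in
/-- A partition into `m` parts, each inside a neighbourhood, and a small remainder. -/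
theorem exists_partition_in_neighborSets {V : Type*} [Fintype V] [Nonempty V] {G : SimpleGraph V}
    (hdeg : ∀ v, Fintype.card V ≤ 5 * G.degree v) (m : ℕ) :
    ∃ (w : Fin m → V) (p : V → Option (Fin m)), (∀ j x, p x = some j → G.Adj (w j) x) ∧
      (partSize p none : ℝ) ≤ (4 / 5 : ℝ) ^ m * Fintype.card V := by
  obtain ⟨w, hw⟩ := exists_cover_by_neighborSets hdeg m
  refine ⟨w, fun x => if h : ∃ j, G.Adj (w j) x then some h.choose else none, ?_, ?_⟩
  · intro j x hx
    dsimp only at hx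
    split_ifs at hx with h
    exact Option.some_injective _ hx ▸ h.choose_spec
  · refine le_trans (Nat.cast_le.2 (Finset.card_le_card ?_)) hw
    intro x hx
    simp at hx ⊢
    exact hx

open Classical in
/-- The colour of a vertex: its rounded densities in the parts of a partition. -/
noncomputable def densityColor {V : Type*} [Fintype V] (G : SimpleGraph V) {m : ℕ}
    (p : V → Option (Fin m)) (K : ℕ) (v : V) : Fin m → Fin (K + 1) := fun j =>
  Fin.ofNat (K + 1) ⌈(K : ℝ) * partDegree G p v (some j) / Fintype.card V⌉₊

theorem densityColor_val {V : Type*} [Fintype V] [Nonempty V] (G : SimpleGraph V) {m : ℕ}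
    (p : V → Option (Fin m)) (K : ℕ) (v : V) (j : Fin m) :
    (densityColor G p K v j).val = ⌈(K : ℝ) * partDegree G p v (some j) / Fintype.card V⌉₊ := by
  have hn : (0 : ℝ) < Fintype.card V := by exact_mod_cast Fintype.card_pos
  refine Nat.mod_eq_of_lt (Nat.lt_succ_of_le (Nat.ceil_le.2 ?_))
  rw [div_le_iff₀ hn]
  gcongr
  exact Finset.card_le_univ _

theorem partDegree_le_of_densityColor_eq {V : Type*} [Fintype V] [Nonempty V] {G : SimpleGraph V}
    {m : ℕ} {p : V → Option (Fin m)} {K : ℕ} (hK : 0 < K) {u v : V}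
    (h : densityColor G p K u = densityColor G p K v) (j : Fin m) :
    (partDegree G p u (some j) : ℝ) ≤ partDegree G p v (some j) + Fintype.card V / K := by
  have hn : (0 : ℝ) < Fintype.card V := by exact_mod_cast Fintype.card_pos
  have hK' : (0 : ℝ) < K := by exact_mod_cast hK
  have hj := congrArg Fin.val (congrFun h j)
  rw [densityColor_val, densityColor_val] at hj
  have h1 := Nat.le_ceil ((K : ℝ) * partDegree G p u (some j) / Fintype.card V)
  have h2 := Nat.ceil_lt_add_one
    (show 0 ≤ (K : ℝ) * partDegree G p v (some j) / Fintype.card V by positivity)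
  rw [hj] at h1
  have h3 := h1.trans h2.le
  rw [div_add_one hn.ne', div_le_div_iff_of_pos_right hn] at h3
  rw [← mul_le_mul_iff_right₀ hK', mul_add, mul_div_cancel₀ _ hK'.ne']
  exact h3

/-- Densities are rounded up, so only density zero gets the value 0. -/
theorem partDegree_eq_zero_of_densityColor_eq {V : Type*} [Fintype V] [Nonempty V]
    {G : SimpleGraph V} {m : ℕ} {p : V → Option (Fin m)} {K : ℕ} (hK : 0 < K) {u v : V}
    (h : densityColor G p K u = densityColor G p K v) {j : Fin m}
    (hv : partDegree G p v (some j) = 0) : partDegree G p u (some j) = 0 := by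
  have hn : (0 : ℝ) < Fintype.card V := by exact_mod_cast Fintype.card_pos
  have hK' : (0 : ℝ) < K := by exact_mod_cast hK
  have hj := congrArg Fin.val (congrFun h j)
  rw [densityColor_val, densityColor_val, hv, Nat.cast_zero, mul_zero, zero_div, Nat.ceil_zero,
    Nat.ceil_eq_zero, div_le_iff₀ hn, zero_mul] at hj
  have : (partDegree G p u (some j) : ℝ) ≤ 0 := by
    by_contra! hc
    exact absurd hj (not_le.2 (mul_pos hK' hc))
  exact_mod_cast this.antisymm (Nat.cast_nonneg _)

/-! ### The bound above 1/5, and the threshold -/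

open Classical in
theorem exists_homToFree_bound {ε : ℝ} (hε : 0 < ε) :
    ∃ C : ℕ, ∀ (V : Type*) [Fintype V] (G : SimpleGraph V), FamilyFree C3C5 G →
      (1 / 5 + ε) * (Fintype.card V : ℝ) ≤ (G.minDegree : ℝ) → HomToFreeOfOrderLE C3C5 C G := by
  obtain ⟨m, hm⟩ := exists_pow_lt_of_lt_one (show 0 < ε / 2 by positivity)
    (show (4 / 5 : ℝ) < 1 by norm_num)
  obtain ⟨K, hK⟩ := exists_nat_gt (m / ε : ℝ)
  have hK' : (0 : ℝ) < K := lt_of_le_of_lt (by positivity) hK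
  have hK0 : 0 < K := by exact_mod_cast hK'
  -- Depth 7 pays for the seven edges of the lifted walk.
  refine ⟨Nat.card (DepthType (Fin m → Fin (K + 1)) 7), fun V _ G hG hdeg => ?_⟩
  have hdeg' : ∀ v, (1 / 5 + ε) * (Fintype.card V : ℝ) ≤ G.degree v := fun v =>
    hdeg.trans (Nat.cast_le.2 (G.minDegree_le_degree v))
  obtain ⟨p, hp⟩ : ∃ p : V → Option (Fin m), Nonempty V →
      (∃ w : Fin m → V, ∀ j x, p x = some j → G.Adj (w j) x) ∧
      (partSize p none : ℝ) ≤ (4 / 5 : ℝ) ^ m * Fintype.card V := by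
    by_cases hV : Nonempty V
    · obtain ⟨w, p, h1, h2⟩ := exists_partition_in_neighborSets (G := G) (fun v => by
        have := hdeg' v
        have h5 : (Fintype.card V : ℝ) ≤ 5 * G.degree v := by nlinarith
        exact_mod_cast h5) m
      exact ⟨p, fun _ => ⟨⟨w, h1⟩, h2⟩⟩
    · exact ⟨fun _ => none, fun h => absurd h hV⟩
  refine homToFree_of_coloring (refineColoring G (densityColor G p K) 7) ?_
  intro a b hab hba hper
  have hV : Nonempty V := ⟨a 0⟩
  have hn : (0 : ℝ) < Fintype.card V := by exact_mod_cast Fintype.card_pos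
  obtain ⟨⟨w, hw⟩, hnone⟩ := hp hV
  obtain ⟨v, hv, hc⟩ := exists_walk_of_quotient_walk hab hba
  have hcol : ∀ i < 3, densityColor G p K (v i) = densityColor G p K (v (i + 5)) := by
    intro i hi
    rw [hc i (by omega), hc (i + 5) (by omega), hper]
  have hpart : ∀ j : Fin m, ∑ i ∈ Finset.range 5, (partDegree G p (v i) (some j) : ℝ) ≤
      partSize p (some j) + Fintype.card V / K := fun j =>
    sum_partDegree_le_of_periodic hG (hw j) hv (by positivity)
      (partDegree_eq_zero_of_densityColor_eq hK0 (hcol 0 (by norm_num)))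
      (fun i hi => partDegree_le_of_densityColor_eq hK0 (hcol i hi) j)
  have hrest : ∑ i ∈ Finset.range 5, (partDegree G p (v i) none : ℝ) ≤ 5 * partSize p none := by
    calc _ ≤ ∑ _i ∈ Finset.range 5, (partSize p none : ℝ) :=
          Finset.sum_le_sum fun i _ => Nat.cast_le.2 (partDegree_le_partSize _ _ _)
      _ = _ := by simp
  have hlow : 5 * ((1 / 5 + ε) * (Fintype.card V : ℝ)) ≤
      ∑ i ∈ Finset.range 5, (G.degree (v i) : ℝ) := by
    calc _ = ∑ _i ∈ Finset.range 5, (1 / 5 + ε) * (Fintype.card V : ℝ) := by simp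
      _ ≤ _ := Finset.sum_le_sum fun i _ => hdeg' _
  have hsum : ∑ i ∈ Finset.range 5, (G.degree (v i) : ℝ) =
      ∑ i ∈ Finset.range 5, (partDegree G p (v i) none : ℝ) +
        ∑ j : Fin m, ∑ i ∈ Finset.range 5, (partDegree G p (v i) (some j) : ℝ) := by
    rw [Finset.sum_comm, ← Finset.sum_add_distrib]
    refine Finset.sum_congr rfl fun i _ => ?_
    rw [← sum_partDegree p (v i), Fintype.sum_option]
    push_cast
    rfl
  have hsize : (partSize p none : ℝ) + ∑ j : Fin m, (partSize p (some j) : ℝ) =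
      Fintype.card V := by
    rw [← sum_partSize p, Fintype.sum_option]
    push_cast
    rfl
  have hup : ∑ j : Fin m, ∑ i ∈ Finset.range 5, (partDegree G p (v i) (some j) : ℝ) ≤
      ∑ j : Fin m, (partSize p (some j) : ℝ) + m * (Fintype.card V / K) := by
    refine (Finset.sum_le_sum fun j _ => hpart j).trans_eq ?_
    rw [Finset.sum_add_distrib]
    simp
  have hmK : (m : ℝ) * (Fintype.card V / K) ≤ ε * Fintype.card V := by
    rw [div_lt_iff₀ hε] at hK
    rw [← mul_div_assoc, div_le_iff₀ hK']
    nlinarith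
  have hnone' : (partSize p none : ℝ) < ε / 2 * Fintype.card V :=
    hnone.trans_lt (mul_lt_mul_of_pos_right hm hn)
  -- The degree sum is at least (1 + 5ε)n, but below n + εn + 4(ε/2)n: the remainder is counted five
  -- times instead of once.
  nlinarith [mul_pos hε hn]

theorem homThreshold_C3C5 : homThreshold C3C5 = 1 / 5 := by
  classical
  unfold homThreshold
  apply IsGLB.csInf_eq
  · constructor
    · rintro d ⟨hd, C, hC⟩
      by_contra! hlt
      -- F_{C+1} has 5C + 2 > C vertices.
      have hmin := le_minDegree_andrasfaiF (k := C + 1) (by omega)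
      obtain ⟨m, G', hm, hG', ⟨f⟩⟩ := hC _ (andrasfaiF (C + 1)) (andrasfaiF_free (by omega)) (by
        rw [Fintype.card_fin]
        have h1 : ((C + 1 : ℕ) : ℝ) ≤ ((andrasfaiF (C + 1)).minDegree : ℝ) := by
          exact_mod_cast hmin
        refine le_trans ?_ (h1.trans_eq (by congr!))
        have hC0 : (0 : ℝ) ≤ C := Nat.cast_nonneg C
        rw [Nat.add_sub_cancel]
        push_cast
        nlinarith)
      have := Fintype.card_le_of_injective f (andrasfaiF_hom_injective (by omega) hG' f)
      simp only [Fintype.card_fin] at this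
      omega
    · intro x hx
      apply le_of_forall_pos_le_add
      intro ε hε
      -- The cap 4/5 keeps the density within [0, 1].
      obtain ⟨C, hC⟩ := exists_homToFree_bound.{0} (show 0 < min ε (4 / 5) by positivity)
      refine (hx ⟨⟨by positivity, ?_⟩, C, fun V _ G hG hd => hC V G hG (by convert hd)⟩).trans
        (show 1 / 5 + min ε (4 / 5) ≤ 1 / 5 + ε by gcongr; exact min_le_left _ _)
      linarith [min_le_right ε (4 / 5)]
  · obtain ⟨C, hC⟩ := exists_homToFree_bound.{0} (show (0 : ℝ) < 4 / 5 by norm_num)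
    exact ⟨1 / 5 + 4 / 5, by norm_num, C, fun V _ G hG hd => hC V G hG (by convert hd)⟩

open Classical in
theorem mainTheorem2 :
    homThreshold C3C5 = 1 / 5 ∧
    (∀ ε : ℝ, 0 < ε → ∃ C : ℕ, ∀ (V : Type*) [Fintype V] (G : SimpleGraph V),
      FamilyFree C3C5 G → (1 / 5 + ε) * (Fintype.card V : ℝ) ≤ (G.minDegree : ℝ) →
        HomToFreeOfOrderLE C3C5 C G) ∧
    (∀ k : ℕ, 1 ≤ k →
      FamilyFree C3C5 (andrasfaiF k) ∧
      (Fintype.card (Fin (5 * (k - 1) + 2)) : ℝ) / 5 ≤ ((andrasfaiF k).minDegree : ℝ) ∧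
      ∀ (W : Type*) [Fintype W] (H : SimpleGraph W), FamilyFree C3C5 H →
        Fintype.card W < Fintype.card (Fin (5 * (k - 1) + 2)) →
          IsEmpty (andrasfaiF k →g H)) := by
  refine ⟨homThreshold_C3C5, fun ε hε => exists_homToFree_bound hε,
    fun k hk => ⟨andrasfaiF_free hk, ?_, ?_⟩⟩
  · have hmin : (k : ℝ) ≤ ((andrasfaiF k).minDegree : ℝ) := by
      exact_mod_cast le_minDegree_andrasfaiF hk
    rw [Fintype.card_fin, div_le_iff₀ (by norm_num)]
    have hN : ((5 * (k - 1) + 2 : ℕ) : ℝ) ≤ ((5 * k : ℕ) : ℝ) := Nat.cast_le.2 (by omega)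
    push_cast at hN ⊢
    linarith
  · intro W _ H hH hcard
    exact ⟨fun f => absurd (Fintype.card_le_of_injective f (andrasfaiF_hom_injective hk hH f))
      (not_le.2 hcard)⟩
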